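/- Let $n\ge 0$ be an integer and let $u:\{-n,\ldots,n\}\to\mathbb{R}$, extended by zero to $\mathbb{Z}$, be symmetric ($u(-k)=u(k)$) with $\sum_{k=-n}^{n}u(k)=1$ and nonnegative Fourier transform, i.e. $\widehat{u}(\xi)=\sum_{k\in\mathbb{Z}}u(k)e^{-i\xi k}\ge 0$ for all $\xi\in\mathbb{R}$. For $f:\mathbb{Z}\to\mathbb{C}$ write $(\Delta f)(k)=f(k+2)-2f(k+1)+f(k)$. Then $f\mapsto\Delta(f*u)$ is a bounded linear operator on the complex space $\ell^2(\mathbb{Z})$, and $$\sup_{0\neq f\in\ell^2(\mathbb{Z})}\frac{\|\Delta(f*u)\|_{\ell^2(\mathbb{Z})}}{\|f\|_{\ell^2(\mathbb{Z})}}\ \ge\ \frac{4}{(n+1)^2},$$ with equality if and only if $u$ is the triangle function $u(k)=\frac{n+1-|k|}{(n+1)^2}$ for $|k|\le n$. Moreover, the Fourier transform of the triangle function is the normalized Fejér kernel $$\frac{1}{(n+1)^2}\cdot\frac{1-\cos((n+1)\xi)}{1-\cos\xi}\qquad(\xi\notin 2\pi\mathbb{Z}),$$ with value $1$ for $\xi\in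 2\pi\mathbb{Z}$. -/

import Mathlib

open scoped DiscreteConvolution ComplexOrder lp

noncomputable section

/-- The discrete second derivative `(Δ f)(k) = (∇² f)(k) = f (k+2) - 2 f (k+1) + f k` of a function
on `ℤ`. -/
def discreteLaplacian (f : ℤ → ℂ) : ℤ → ℂ :=
  fun k => f (k + 2) - 2 * f (k + 1) + f k

/-- It is the twofold application of the forward difference operator. -/
theorem discreteLaplacian_eq_fwdDiff (f : ℤ → ℂ) :
    discreteLaplacian f = fwdDiff 1 (fwdDiff 1 f) := by
  funext k
  simp only [discreteLaplacian, fwdDiff]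
  rw [show k + 1 + 1 = k + 2 by ring]
  ring

/-- The convolution `(f * u)(k) = ∑_{i + j = k} f i * u j` of a complex function and a real
kernel on `ℤ`. -/
def convolve (f : ℤ → ℂ) (u : ℤ → ℝ) : ℤ → ℂ :=
  f ⋆₊[LinearMap.mul ℂ ℂ] (fun k => (u k : ℂ))

/-- The Fourier transform `û(ξ) = ∑_{k ∈ ℤ} u k * e^{-iξk}`. -/
def fourierSeries (u : ℤ → ℝ) (ξ : ℝ) : ℂ :=
  ∑' k : ℤ, (u k : ℂ) * Complex.exp (-Complex.I * ξ * k)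

/-- The triangle function on `{-n, …, n}`, extended by zero to `ℤ`. -/
def triangle (n : ℕ) (k : ℤ) : ℝ :=
  if |k| ≤ n then ((n : ℝ) + 1 - |(k : ℝ)|) / ((n : ℝ) + 1) ^ 2 else 0

/-- The Fejér kernel normalized to take the value `1` at `0`. For `ξ ∉ 2πℤ` it is
`(1 - cos ((n+1)ξ)) / ((n+1)² (1 - cos ξ))`; its continuous extension to `2πℤ` is `1` there. -/
def normalizedFejer (n : ℕ) (ξ : ℝ) : ℝ :=
  if Real.cos ξ = 1 then 1
  else (1 / ((n : ℝ) + 1) ^ 2) * ((1 - Real.cos (((n : ℝ) + 1) * ξ)) / (1 - Real.cos ξ))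

/-- The convolution as a sum over `ℤ`. -/
theorem convolve_apply (f : ℤ → ℂ) (u : ℤ → ℝ) (k : ℤ) :
    convolve f u k = ∑' j : ℤ, f (k - j) * (u j : ℂ) := by
  let e : ℤ ≃ DiscreteConvolution.addFiber k :=
    { toFun := fun j => ⟨(k - j, j), by simp [DiscreteConvolution.mem_addFiber]⟩
      invFun := fun p => p.1.2
      left_inv := fun j => rfl
      right_inv := fun p => by
        obtain ⟨⟨a, b⟩, h⟩ := p
        have h' : a + b = k := by simpa [DiscreteConvolution.mem_addFiber] using h
        apply Subtype.ext
        simp [← h'] }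
  unfold convolve DiscreteConvolution.addConvolution
  rw [← e.tsum_eq]
  rfl

end

open Finset

/-! ### Sums over symmetric intervals -/

/-! On the Fourier side the operator is multiplication by `(e^{iξ} - 1)² û(ξ)`, of modulus `(2 - 2
cos ξ) û(ξ)`, and the supremum dominates this symbol (`symbol_le_of_norm_le`). Suppose the symbol is
at most `4/(n+1)²`, and let `D` be `u` minus the triangle. At the nodes `πj/(n+1)`, `0 ≤ j <
2(n+1)`, the triangle's transform vanishes for even `j > 0`, while its symbol equals `4/(n+1)²` for
odd `j`. Hence `(-1)^j D̂ ≥ 0` at every node. The alternating sum of these values is a multiple of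
`D(n+1) = 0`, so all of them vanish and discrete inversion gives `D = 0`
(`eq_triangle_of_symbol_le`). So a bound `≤ 4/(n+1)²` forces the triangle, whose symbol attains that
value at `π/(n+1)`; this yields both the inequality and uniqueness. Summation by parts shows that
the triangle does not exceed it. -/

theorem sum_Icc_neg_succ (F : ℤ → ℂ) (n : ℕ) :
    ∑ k ∈ Icc (-((n + 1 : ℕ) : ℤ)) ((n + 1 : ℕ) : ℤ), F k =
      ∑ k ∈ Icc (-(n : ℤ)) n, F k + (F (n + 1) + F (-(n + 1))) := by
  have h : Icc (-((n + 1 : ℕ) : ℤ)) ((n + 1 : ℕ) : ℤ) =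
      insert ((n : ℤ) + 1) (insert (-((n : ℤ) + 1)) (Icc (-(n : ℤ)) n)) := by
    ext k
    simp only [mem_Icc, mem_insert]
    omega
  rw [h, sum_insert, sum_insert]
  · ring
  · simp
  · simp only [mem_insert, mem_Icc]
    omega

theorem sum_Icc_secondDiff (g : ℤ → ℂ) (n : ℕ) :
    ∑ k ∈ Icc (-(n : ℤ)) n, (g (k + 1) - 2 * g k + g (k - 1)) =
      g (n + 1) - g n - g (-n) + g (-n - 1) := by
  induction n with
  | zero => simp; ring
  | succ n ih =>
    rw [sum_Icc_neg_succ, ih]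
    push_cast
    rw [show (n : ℤ) + 1 - 1 = n by ring, show -((n : ℤ) + 1) + 1 = -n by ring,
      show -(n : ℤ) - 1 = -(n + 1) by ring]
    ring

/-- Summation by parts against the triangle weights. -/
theorem sum_Icc_triangle_secondDiff (g : ℤ → ℂ) (n : ℕ) :
    ∑ k ∈ Icc (-(n : ℤ)) n,
        ((n : ℂ) + 1 - ((|k| : ℤ) : ℂ)) * (g (k + 1) - 2 * g k + g (k - 1)) =
      g (n + 1) - 2 * g 0 + g (-(n + 1)) := by
  induction n with
  | zero => simp
  | succ n ih =>
    have h1 : |(n : ℤ) + 1| = n + 1 := abs_of_nonneg (by positivity)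
    have h := sum_Icc_secondDiff g (n + 1)
    -- Passing to `n + 1` raises every weight by 1, and the old weight vanishes at the new endpoints
    -- `±(n+1)`.
    calc _ = ∑ k ∈ Icc (-((n + 1 : ℕ) : ℤ)) ((n + 1 : ℕ) : ℤ),
          (((n : ℂ) + 1 - ((|k| : ℤ) : ℂ)) * (g (k + 1) - 2 * g k + g (k - 1)) +
            (g (k + 1) - 2 * g k + g (k - 1))) := by
          refine sum_congr rfl fun k _ => ?_
          push_cast
          ring
      _ = _ := by
          rw [sum_add_distrib, h, sum_Icc_neg_succ, ih, abs_neg, h1]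
          push_cast
          rw [show -((n : ℤ) + 1) - 1 = -(n + 1 + 1) by ring]
          ring

theorem sum_Icc_neg_comm (F : ℤ → ℂ) (n : ℕ) :
    ∑ k ∈ Icc (-(n : ℤ)) n, F (-k) = ∑ k ∈ Icc (-(n : ℤ)) n, F k := by
  refine sum_nbij' (fun k => -k) (fun k => -k) ?_ ?_ ?_ ?_ ?_ <;> simp <;> omega

/-! ### The Fourier transform of a finitely supported kernel -/

theorem fourierSeries_eq_sum {n : ℕ} {u : ℤ → ℝ} (hu : ∀ k : ℤ, (n : ℤ) < |k| → u k = 0)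
    (ξ : ℝ) :
    fourierSeries u ξ =
      ∑ k ∈ Icc (-(n : ℤ)) n, (u k : ℂ) * Complex.exp (-Complex.I * ξ * k) := by
  refine tsum_eq_sum fun k hk => ?_
  have : (n : ℤ) < |k| := by
    rw [mem_Icc, ← abs_le] at hk
    omega
  simp [hu k this]

/-- The real cosine form of the Fourier transform of a symmetric kernel. -/
noncomputable def cosineSeries (n : ℕ) (u : ℤ → ℝ) (ξ : ℝ) : ℝ :=
  ∑ k ∈ Icc (-(n : ℤ)) n, u k * Real.cos (k * ξ)

theorem fourierSeries_eq_cosineSeries {n : ℕ} {u : ℤ → ℝ}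
    (hu : ∀ k : ℤ, (n : ℤ) < |k| → u k = 0) (hsymm : ∀ k : ℤ, u (-k) = u k) (ξ : ℝ) :
    fourierSeries u ξ = cosineSeries n u ξ := by
  have h := sum_Icc_neg_comm (fun k => (u k : ℂ) * Complex.exp (-Complex.I * ξ * k)) n
  rw [← fourierSeries_eq_sum hu] at h
  have h2 : 2 * fourierSeries u ξ = 2 * (cosineSeries n u ξ : ℂ) := by
    rw [two_mul]
    nth_rw 1 [← h]
    rw [fourierSeries_eq_sum hu, ← sum_add_distrib, cosineSeries]
    push_cast
    rw [mul_sum]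
    refine sum_congr rfl fun k _ => ?_
    rw [hsymm, Complex.cos]
    rw [show -Complex.I * (ξ : ℂ) * -(k : ℂ) = k * ξ * Complex.I by ring,
      show -Complex.I * (ξ : ℂ) * (k : ℂ) = -(k * ξ) * Complex.I by ring]
    ring
  exact mul_left_cancel₀ two_ne_zero h2

/-! ### The triangle function -/

theorem triangle_of_lt_abs (n : ℕ) (k : ℤ) (hk : (n : ℤ) < |k|) : triangle n k = 0 := by
  rw [triangle, if_neg (not_le.mpr hk)]

theorem triangle_neg (n : ℕ) (k : ℤ) : triangle n (-k) = triangle n k := by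
  simp [triangle]

theorem sum_triangle_mul_secondDiff (g : ℤ → ℂ) (n : ℕ) :
    ∑ k ∈ Icc (-(n : ℤ)) n, (triangle n k : ℂ) * (g (k + 1) - 2 * g k + g (k - 1)) =
      (g (n + 1) - 2 * g 0 + g (-(n + 1))) / ((n : ℂ) + 1) ^ 2 := by
  rw [← sum_Icc_triangle_secondDiff, sum_div]
  refine sum_congr rfl fun k hk => ?_
  rw [mem_Icc, ← abs_le] at hk
  rw [triangle, if_pos hk, ← Int.cast_abs]
  push_cast [-Int.cast_abs]
  ring

theorem cosineSeries_triangle_mul (n : ℕ) (ξ : ℝ) :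
    (1 - Real.cos ξ) * cosineSeries n (triangle n) ξ =
      (1 - Real.cos (((n : ℝ) + 1) * ξ)) / ((n : ℝ) + 1) ^ 2 := by
  -- The second difference of `cos(kξ)` in `k` is `-2(1 - cos ξ) cos(kξ)`.
  have h := sum_triangle_mul_secondDiff (fun k => (Real.cos (k * ξ) : ℂ)) n
  have h' : ∑ k ∈ Icc (-(n : ℤ)) n, triangle n k *
      (Real.cos ((k + 1 : ℤ) * ξ) - 2 * Real.cos (k * ξ) + Real.cos ((k - 1 : ℤ) * ξ)) =
      (Real.cos ((n + 1 : ℤ) * ξ) - 2 * Real.cos ((0 : ℤ) * ξ) +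
        Real.cos ((-(n + 1) : ℤ) * ξ)) / ((n : ℝ) + 1) ^ 2 := by
    exact_mod_cast h
  have h1 : ∑ k ∈ Icc (-(n : ℤ)) n, triangle n k *
      (Real.cos ((k + 1 : ℤ) * ξ) - 2 * Real.cos (k * ξ) + Real.cos ((k - 1 : ℤ) * ξ)) =
      -2 * ((1 - Real.cos ξ) * cosineSeries n (triangle n) ξ) := by
    rw [cosineSeries, mul_sum, mul_sum]
    refine sum_congr rfl fun k _ => ?_
    push_cast
    rw [add_mul, sub_mul, one_mul, Real.cos_add, Real.cos_sub]
    ring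
  rw [h1] at h'
  push_cast at h'
  rw [neg_mul (_ + _) ξ, Real.cos_neg, zero_mul, Real.cos_zero] at h'
  linear_combination (-1 / 2 : ℝ) * h'

theorem sum_triangle (n : ℕ) : ∑ k ∈ Icc (-(n : ℤ)) n, triangle n k = 1 := by
  -- The second difference of `k²` is constantly 2, so the identity evaluates twice the total mass.
  have h := sum_triangle_mul_secondDiff (fun k => (k : ℂ) ^ 2) n
  have h1 : ∑ k ∈ Icc (-(n : ℤ)) n, (triangle n k : ℂ) *
      (((k + 1 : ℤ) : ℂ) ^ 2 - 2 * (k : ℂ) ^ 2 + ((k - 1 : ℤ) : ℂ) ^ 2) =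
      2 * ∑ k ∈ Icc (-(n : ℤ)) n, (triangle n k : ℂ) := by
    rw [mul_sum]
    refine sum_congr rfl fun k _ => ?_
    push_cast
    ring
  rw [h1] at h
  have h2 : (n : ℂ) + 1 ≠ 0 := Nat.cast_add_one_ne_zero n
  push_cast at h
  have h3 : ∑ k ∈ Icc (-(n : ℤ)) n, (triangle n k : ℂ) = 1 := by
    field_simp at h
    ring_nf at h
    have h4 : (1 + (n : ℂ) * 2 + n ^ 2) ≠ 0 := by
      rw [show 1 + (n : ℂ) * 2 + n ^ 2 = (n + 1) ^ 2 by ring]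
      exact pow_ne_zero 2 h2
    refine mul_left_cancel₀ h4 ?_
    linear_combination h / 2
  exact_mod_cast h3

theorem cosineSeries_of_cos_eq_one {n : ℕ} {u : ℤ → ℝ} {ξ : ℝ} (hξ : Real.cos ξ = 1) :
    cosineSeries n u ξ = ∑ k ∈ Icc (-(n : ℤ)) n, u k := by
  obtain ⟨m, rfl⟩ := (Real.cos_eq_one_iff ξ).mp hξ
  refine sum_congr rfl fun k _ => ?_
  rw [← mul_assoc, ← Int.cast_mul, Real.cos_int_mul_two_pi, mul_one]

theorem cosineSeries_triangle (n : ℕ) (ξ : ℝ) :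
    cosineSeries n (triangle n) ξ = normalizedFejer n ξ := by
  unfold normalizedFejer
  split_ifs with h
  · rw [cosineSeries_of_cos_eq_one h, sum_triangle]
  · have h' : 1 - Real.cos ξ ≠ 0 := sub_ne_zero.mpr (Ne.symm h)
    have := cosineSeries_triangle_mul n ξ
    field_simp at this ⊢
    linear_combination this

theorem fourierSeries_triangle (n : ℕ) (ξ : ℝ) :
    fourierSeries (triangle n) ξ = normalizedFejer n ξ := by
  rw [fourierSeries_eq_cosineSeries (triangle_of_lt_abs n) (triangle_neg n),
    cosineSeries_triangle]

/-! ### Shifts on `ℓ²(ℤ)` and the operator `f ↦ Δ (f * u)` -/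

theorem lp_two_norm_sq (f : ℓ²(ℤ, ℂ)) : ‖f‖ ^ 2 = ∑' k, ‖f k‖ ^ 2 := by
  simpa using lp.norm_rpow_eq_tsum (p := 2) (by simp) f

theorem lp_two_summable (f : ℓ²(ℤ, ℂ)) : Summable fun k => ‖f k‖ ^ 2 := by
  simpa using (lp.memℓp f).summable (by simp)

/-- The translation `f ↦ f (· + m)` on `ℓ²(ℤ)`. -/
noncomputable def lpShift (m : ℤ) : ℓ²(ℤ, ℂ) →ₗᵢ[ℂ] ℓ²(ℤ, ℂ) where
  toFun f := ⟨fun k => f (k + m), memℓp_gen <| by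
    simpa [Function.comp_def] using (Equiv.addRight m).summable_iff.mpr (lp_two_summable f)⟩
  map_add' f g := rfl
  map_smul' c f := rfl
  norm_map' f := by
    rw [← sq_eq_sq₀ (norm_nonneg _) (norm_nonneg _), lp_two_norm_sq, lp_two_norm_sq]
    exact (Equiv.addRight m).tsum_eq (fun k => ‖f k‖ ^ 2)

theorem lpShift_apply (m : ℤ) (f : ℓ²(ℤ, ℂ)) (k : ℤ) : lpShift m f k = f (k + m) := rfl

/-- The operator `f ↦ Δ (f * u)` for a kernel `u` supported in `{-n, …, n}`. -/
noncomputable def laplacianConvolve (n : ℕ) (u : ℤ → ℝ) : ℓ²(ℤ, ℂ) →L[ℂ] ℓ²(ℤ, ℂ) :=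
  ∑ j ∈ Icc (-(n : ℤ)) n, (u j : ℂ) •
    ((lpShift (2 - j)).toContinuousLinearMap - (2 : ℂ) • (lpShift (1 - j)).toContinuousLinearMap +
      (lpShift (-j)).toContinuousLinearMap)

theorem laplacianConvolve_apply (n : ℕ) (u : ℤ → ℝ) (f : ℓ²(ℤ, ℂ)) (k : ℤ) :
    laplacianConvolve n u f k =
      ∑ j ∈ Icc (-(n : ℤ)) n,
        (u j : ℂ) * (f (k + (2 - j)) - 2 * f (k + (1 - j)) + f (k + -j)) := by
  rw [laplacianConvolve, _root_.sum_apply, lp.coeFn_sum, Finset.sum_apply]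
  rfl

theorem convolve_eq_sum {n : ℕ} {u : ℤ → ℝ} (hu : ∀ k : ℤ, (n : ℤ) < |k| → u k = 0)
    (f : ℤ → ℂ) (k : ℤ) :
    convolve f u k = ∑ j ∈ Icc (-(n : ℤ)) n, f (k - j) * (u j : ℂ) := by
  rw [convolve_apply]
  refine tsum_eq_sum fun j hj => ?_
  have : (n : ℤ) < |j| := by
    rw [mem_Icc, ← abs_le] at hj
    omega
  simp [hu j this]

theorem coe_laplacianConvolve {n : ℕ} {u : ℤ → ℝ} (hu : ∀ k : ℤ, (n : ℤ) < |k| → u k = 0)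
    (f : ℓ²(ℤ, ℂ)) :
    (laplacianConvolve n u f : ℤ → ℂ) = discreteLaplacian (convolve f u) := by
  funext k
  rw [laplacianConvolve_apply, discreteLaplacian, convolve_eq_sum hu, convolve_eq_sum hu,
    convolve_eq_sum hu, mul_sum, ← sum_sub_distrib, ← sum_add_distrib]
  refine sum_congr rfl fun j _ => ?_
  rw [show k + (2 - j) = k + 2 - j by ring, show k + (1 - j) = k + 1 - j by ring, ← sub_eq_add_neg]
  ring

/-- Summation by parts collapses the operator to three isometric shifts with coefficients 1, -2, 1
over `(n+1)²`; the triangle inequality gives the 4. -/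
theorem norm_laplacianConvolve_triangle_le (n : ℕ) (f : ℓ²(ℤ, ℂ)) :
    ‖laplacianConvolve n (triangle n) f‖ ≤ 4 / ((n : ℝ) + 1) ^ 2 * ‖f‖ := by
  have h : laplacianConvolve n (triangle n) f = (((n : ℂ) + 1) ^ 2)⁻¹ •
      (lpShift (1 - (n + 1)) f - (2 : ℂ) • lpShift 1 f + lpShift (1 + (n + 1)) f) := by
    refine lp.ext (funext fun k => ?_)
    have := sum_triangle_mul_secondDiff (fun j => f (k + (1 - j))) n
    rw [laplacianConvolve_apply]
    change _ = (((n : ℂ) + 1) ^ 2)⁻¹ *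
      (f (k + (1 - (n + 1))) - 2 * f (k + 1) + f (k + (1 + (n + 1))))
    rw [sub_zero, sub_neg_eq_add, div_eq_inv_mul] at this
    rw [← this]
    refine sum_congr rfl fun j _ => ?_
    rw [show 1 - (j + 1) = -j by ring, show 1 - (j - 1) = 2 - j by ring]
    ring
  have hN : ‖(((n : ℂ) + 1) ^ 2)⁻¹‖ = (((n : ℝ) + 1) ^ 2)⁻¹ := by
    rw [norm_inv, norm_pow]
    congr 2
    exact_mod_cast Complex.norm_natCast (n + 1)
  rw [h, norm_smul, hN, div_eq_inv_mul, mul_assoc]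
  gcongr
  refine (norm_add_le _ _).trans ?_
  refine (add_le_add_left (norm_sub_le _ _) _).trans ?_
  rw [norm_smul, LinearIsometry.norm_map, LinearIsometry.norm_map, LinearIsometry.norm_map,
    Complex.norm_ofNat]
  linarith

/-! ### The operator norm dominates the symbol -/

/-- The character `k ↦ e^{iξk}` cut off to `{0, …, L - 1}`. -/
noncomputable def truncatedExp (ξ : ℝ) (L : ℕ) : ℓ²(ℤ, ℂ) :=
  ∑ k ∈ Ico (0 : ℤ) L, lp.single 2 k (Complex.exp (Complex.I * ξ * k))

theorem truncatedExp_apply {ξ : ℝ} {L : ℕ} {k : ℤ} (h0 : 0 ≤ k) (hL : k < L) :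
    truncatedExp ξ L k = Complex.exp (Complex.I * ξ * k) := by
  rw [truncatedExp, lp.coeFn_sum, Finset.sum_apply, sum_eq_single k]
  · simp
  · intro j _ hj
    simp [hj.symm]
  · intro h
    exact absurd (mem_Ico.mpr ⟨h0, hL⟩) h

theorem norm_exp_I_mul_mul (ξ : ℝ) (k : ℤ) : ‖Complex.exp (Complex.I * ξ * k)‖ = 1 := by
  rw [show Complex.I * (ξ : ℂ) * k = ((ξ * k : ℝ) : ℂ) * Complex.I by push_cast; ring]
  exact Complex.norm_exp_ofReal_mul_I _

theorem norm_truncatedExp_sq (ξ : ℝ) (L : ℕ) : ‖truncatedExp ξ L‖ ^ 2 = L := by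
  have h := lp.norm_sum_single (E := fun _ : ℤ => ℂ) (p := 2) (by simp)
    (fun k : ℤ => Complex.exp (Complex.I * ξ * k)) (Ico (0 : ℤ) L)
  simpa [norm_exp_I_mul_mul, truncatedExp] using h

theorem laplacianConvolve_truncatedExp {n : ℕ} {u : ℤ → ℝ}
    (hu : ∀ k : ℤ, (n : ℤ) < |k| → u k = 0) {ξ : ℝ} {L : ℕ} {k : ℤ}
    (h0 : n ≤ k) (hL : k + 2 + n < L) :
    laplacianConvolve n u (truncatedExp ξ L) k =
      Complex.exp (Complex.I * ξ * k) *
        ((Complex.exp (Complex.I * ξ) - 1) ^ 2 * fourierSeries u ξ) := by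
  rw [laplacianConvolve_apply, fourierSeries_eq_sum hu, mul_sum, mul_sum]
  refine sum_congr rfl fun j hj => ?_
  rw [mem_Icc] at hj
  rw [truncatedExp_apply (by omega) (by omega), truncatedExp_apply (by omega) (by omega),
    truncatedExp_apply (by omega) (by omega)]
  push_cast
  rw [show Complex.I * (ξ : ℂ) * (k + (2 - j)) = Complex.I * ξ * k +
      (Complex.I * ξ + Complex.I * ξ) + -Complex.I * ξ * j by ring,
    show Complex.I * (ξ : ℂ) * (k + (1 - j)) = Complex.I * ξ * k +
      Complex.I * ξ + -Complex.I * ξ * j by ring,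
    show Complex.I * (ξ : ℂ) * (k + -j) = Complex.I * ξ * k + -Complex.I * ξ * j by ring]
  simp only [Complex.exp_add]
  ring

theorem norm_exp_sub_one_sq (ξ : ℝ) :
    ‖Complex.exp (Complex.I * ξ) - 1‖ ^ 2 = 2 - 2 * Real.cos ξ := by
  rw [mul_comm, Complex.exp_mul_I, ← Complex.normSq_eq_norm_sq, Complex.normSq_apply]
  simp [Complex.cos_ofReal_re, Complex.sin_ofReal_re]
  nlinarith [Real.sin_sq_add_cos_sq ξ]

/-- A character truncated to length `L + 2n + 2` behaves as an eigenvector on a window of `L`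
points, since the value at `k` reads only `k - n, …, k + n + 2`. The boundary loss is negligible as
`L` grows. -/
theorem symbol_le_of_norm_le {n : ℕ} {u : ℤ → ℝ} (hu : ∀ k : ℤ, (n : ℤ) < |k| → u k = 0)
    (hsymm : ∀ k : ℤ, u (-k) = u k) {S : ℝ} (hS : 0 ≤ S)
    (hT : ∀ f, ‖laplacianConvolve n u f‖ ≤ S * ‖f‖) (ξ : ℝ) :
    (2 - 2 * Real.cos ξ) * cosineSeries n u ξ ≤ S := by
  set m := (2 - 2 * Real.cos ξ) * cosineSeries n u ξ with hm
  have hwin (L : ℕ) : (L : ℝ) * m ^ 2 ≤ S ^ 2 * (L + (2 * n + 2)) := by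
    have h1 := lp.sum_rpow_le_norm_rpow (p := 2) (by simp)
      (laplacianConvolve n u (truncatedExp ξ (L + (2 * n + 2)))) (Ico (n : ℤ) (n + L))
    have h2 : ∀ k ∈ Ico (n : ℤ) (n + L),
        ‖laplacianConvolve n u (truncatedExp ξ (L + (2 * n + 2))) k‖ ^ 2 = m ^ 2 := by
      intro k hk
      rw [mem_Ico] at hk
      rw [laplacianConvolve_truncatedExp hu (by omega) (by push_cast; omega), norm_mul,
        norm_exp_I_mul_mul, one_mul, norm_mul, norm_pow, norm_exp_sub_one_sq,
        fourierSeries_eq_cosineSeries hu hsymm, Complex.norm_real, mul_pow, Real.norm_eq_abs,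
        sq_abs, hm, mul_pow]
    simp only [ENNReal.toReal_ofNat, Real.rpow_ofNat] at h1
    rw [sum_congr rfl h2] at h1
    simp only [sum_const, Int.card_Ico, add_sub_cancel_left, Int.toNat_natCast, nsmul_eq_mul] at h1
    have h3 := pow_le_pow_left₀ (norm_nonneg _) (hT (truncatedExp ξ (L + (2 * n + 2)))) 2
    rw [mul_pow, norm_truncatedExp_sq] at h3
    push_cast at h3
    exact h1.trans h3
  refine le_of_sq_le_sq ?_ hS
  by_contra! hlt
  obtain ⟨L, hL⟩ := exists_nat_gt (S ^ 2 * (2 * n + 2) / (m ^ 2 - S ^ 2))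
  rw [div_lt_iff₀ (by linarith)] at hL
  linarith [hwin L]

/-! ### Sampling at the `2 (n + 1)`-th roots of unity -/

theorem IsPrimitiveRoot.sum_zpow_mul {ζ : ℂ} {M : ℕ} (hζ : IsPrimitiveRoot ζ M) {m : ℤ}
    (hm : |m| < M) :
    ∑ j ∈ range M, (ζ ^ m) ^ j = if m = 0 then (M : ℂ) else 0 := by
  split_ifs with h
  · simp [h]
  · have h1 : ζ ^ m ≠ 1 := by
      rw [Ne, hζ.zpow_eq_one_iff_dvd]
      intro hd
      exact h (Int.eq_zero_of_abs_lt_dvd hd hm)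
    have h2 : (ζ ^ m) ^ M = 1 := by
      rw [← zpow_natCast, zpow_comm, zpow_natCast, hζ.pow_eq_one, one_zpow]
    rw [geom_sum_eq h1, h2, sub_self, zero_div]

/-- Discrete Fourier inversion on `2 (n + 1)` equispaced nodes. -/
theorem sum_zpow_mul_fourierSeries {n : ℕ} {u : ℤ → ℝ}
    (hu : ∀ k : ℤ, (n : ℤ) < |k| → u k = 0) {l : ℤ} (hl : |l| ≤ n + 1) :
    ∑ j ∈ range (2 * (n + 1)),
        Complex.exp (2 * Real.pi * Complex.I / (2 * (n + 1) : ℕ)) ^ (l * j) *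
          fourierSeries u (Real.pi * j / (n + 1)) =
      (2 * (n + 1) : ℕ) * (u l : ℂ) := by
  set ζ := Complex.exp (2 * Real.pi * Complex.I / (2 * (n + 1) : ℕ)) with hζ
  have hprim : IsPrimitiveRoot ζ (2 * (n + 1)) := Complex.isPrimitiveRoot_exp _ (by omega)
  have hζ0 : ζ ≠ 0 := Complex.exp_ne_zero _
  have hN : (n : ℂ) + 1 ≠ 0 := Nat.cast_add_one_ne_zero n
  have hexp (j : ℕ) (k : ℤ) :
      Complex.exp (-Complex.I * (Real.pi * j / (n + 1) : ℝ) * k) = ζ ^ (-(k * j)) := by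
    rw [hζ, ← Complex.exp_int_mul]
    congr 1
    push_cast
    field_simp
  have hterm : ∀ j ∈ range (2 * (n + 1)),
      ζ ^ (l * j) * fourierSeries u (Real.pi * j / (n + 1)) =
        ∑ k ∈ Icc (-(n : ℤ)) n, (u k : ℂ) * (ζ ^ (l - k)) ^ j := by
    intro j _
    rw [fourierSeries_eq_sum hu, mul_sum]
    refine sum_congr rfl fun k _ => ?_
    rw [hexp, mul_left_comm, ← zpow_add₀ hζ0, ← zpow_natCast, ← zpow_mul]
    congr 2
    ring
  rw [sum_congr rfl hterm, sum_comm]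
  have hinner : ∀ k ∈ Icc (-(n : ℤ)) n,
      ∑ j ∈ range (2 * (n + 1)), (u k : ℂ) * (ζ ^ (l - k)) ^ j =
        if k = l then (2 * (n + 1) : ℕ) * (u l : ℂ) else 0 := by
    intro k hk
    rw [mem_Icc] at hk
    rw [abs_le] at hl
    -- Here `|l - k| ≤ 2n + 1 < 2(n+1)`, so there is no aliasing even for `l = ±(n+1)`, just outside
    -- the support.
    rw [← mul_sum, hprim.sum_zpow_mul (by rw [abs_lt]; push_cast; omega)]
    by_cases h : k = l
    · simp [h, mul_comm]
    · rw [if_neg (by omega), if_neg h, mul_zero]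
  rw [sum_congr rfl hinner, sum_ite_eq']
  split_ifs with h
  · rfl
  · rw [mem_Icc, ← abs_le] at h
    rw [hu l (by omega)]
    simp

theorem eq_zero_of_fourierSeries_nodes_eq_zero {n : ℕ} {u : ℤ → ℝ}
    (hu : ∀ k : ℤ, (n : ℤ) < |k| → u k = 0)
    (h : ∀ j ∈ range (2 * (n + 1)), fourierSeries u (Real.pi * j / (n + 1)) = 0) : u = 0 := by
  funext l
  by_cases hl : (n : ℤ) < |l|
  · exact hu l hl
  · have h1 := sum_zpow_mul_fourierSeries hu (l := l) (by omega)
    rw [sum_eq_zero fun j hj => by rw [h j hj, mul_zero]] at h1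
    have h2 : ((2 * (n + 1) : ℕ) : ℂ) ≠ 0 := by
      rw [Nat.cast_ne_zero]
      omega
    have h3 := (mul_eq_zero.mp h1.symm).resolve_left h2
    exact_mod_cast h3

/-- Inversion at `l = n + 1`: the root of unity raised to that power is -1, and `u` vanishes there.
-/
theorem sum_neg_one_pow_mul_fourierSeries {n : ℕ} {u : ℤ → ℝ}
    (hu : ∀ k : ℤ, (n : ℤ) < |k| → u k = 0) :
    ∑ j ∈ range (2 * (n + 1)), (-1) ^ j * fourierSeries u (Real.pi * j / (n + 1)) = 0 := by
  have habs : |(n : ℤ) + 1| = n + 1 := abs_of_nonneg (by positivity)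
  have h := sum_zpow_mul_fourierSeries hu (l := n + 1) habs.le
  rw [hu (n + 1) (by omega), Complex.ofReal_zero, mul_zero] at h
  rw [← h]
  refine sum_congr rfl fun j _ => ?_
  congr 1
  rw [zpow_mul, zpow_natCast, ← Complex.exp_int_mul]
  congr 1
  rw [← Complex.exp_pi_mul_I]
  congr 1
  have hN : (n : ℂ) + 1 ≠ 0 := Nat.cast_add_one_ne_zero n
  push_cast
  field_simp

/-! ### The extremal problem for the symbol -/

theorem cosineSeries_sub (n : ℕ) (u v : ℤ → ℝ) (ξ : ℝ) :
    cosineSeries n (u - v) ξ = cosineSeries n u ξ - cosineSeries n v ξ := by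
  simp [cosineSeries, sub_mul]

theorem triangle_symbol_node (n j : ℕ) :
    (1 - Real.cos (Real.pi * j / (n + 1))) *
        cosineSeries n (triangle n) (Real.pi * j / (n + 1)) =
      (1 - (-1) ^ j) / ((n : ℝ) + 1) ^ 2 := by
  have hN : (n : ℝ) + 1 ≠ 0 := Nat.cast_add_one_ne_zero n
  rw [cosineSeries_triangle_mul, mul_div_cancel₀ _ hN, mul_comm, Real.cos_nat_mul_pi]

theorem cos_node_lt_one {n j : ℕ} (h0 : 0 < j) (hj : j < 2 * (n + 1)) :
    Real.cos (Real.pi * j / (n + 1)) < 1 := by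
  refine lt_of_le_of_ne (Real.cos_le_one _) fun h => ?_
  have hN : (0 : ℝ) < (n : ℝ) + 1 := by positivity
  have hj' : (j : ℝ) < 2 * (n + 1) := by exact_mod_cast hj
  have hpos : (0 : ℝ) < Real.pi * j / (n + 1) := by positivity
  have hlt : Real.pi * j / (n + 1) < 2 * Real.pi := by
    rw [div_lt_iff₀ hN]
    nlinarith [Real.pi_pos]
  rw [Real.cos_eq_one_iff_of_lt_of_lt (by linarith [Real.pi_pos]) hlt] at h
  exact hpos.ne' h

theorem eq_triangle_of_symbol_le {n : ℕ} {u : ℤ → ℝ} (hu : ∀ k : ℤ, (n : ℤ) < |k| → u k = 0)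
    (hsymm : ∀ k : ℤ, u (-k) = u k) (hsum : ∑ k ∈ Icc (-(n : ℤ)) n, u k = 1)
    (hnonneg : ∀ ξ, 0 ≤ cosineSeries n u ξ)
    (hle : ∀ ξ, (2 - 2 * Real.cos ξ) * cosineSeries n u ξ ≤ 4 / ((n : ℝ) + 1) ^ 2) :
    u = triangle n := by
  have hD : ∀ k : ℤ, (n : ℤ) < |k| → (u - triangle n) k = 0 := fun k hk => by
    simp [hu k hk, triangle_of_lt_abs n k hk]
  have hDsymm : ∀ k : ℤ, (u - triangle n) (-k) = (u - triangle n) k := fun k => by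
    simp [hsymm, triangle_neg]
  have hsign : ∀ j ∈ range (2 * (n + 1)),
      0 ≤ (-1) ^ j * cosineSeries n (u - triangle n) (Real.pi * j / (n + 1)) := by
    intro j hj
    rw [mem_range] at hj
    rw [cosineSeries_sub]
    have hnode := triangle_symbol_node n j
    -- At `j = 0` the factor `1 - cos` vanishes and the symbol bound says nothing; the common
    -- normalization gives equality instead.
    rcases Nat.eq_zero_or_pos j with rfl | hpos
    · rw [cosineSeries_of_cos_eq_one (by simp), cosineSeries_of_cos_eq_one (by simp), hsum,
        sum_triangle]
      simp
    · have hcos := cos_node_lt_one hpos hj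
      rcases Nat.even_or_odd j with he | ho
      · rw [he.neg_one_pow, sub_self, zero_div] at hnode
        rw [he.neg_one_pow, (mul_eq_zero.mp hnode).resolve_left (by linarith), sub_zero, one_mul]
        exact hnonneg _
      · rw [ho.neg_one_pow] at hnode ⊢
        have h1 := hle (Real.pi * j / (n + 1))
        have h2 : (1 - Real.cos (Real.pi * j / (n + 1))) *
            cosineSeries n u (Real.pi * j / (n + 1)) ≤
            (1 - Real.cos (Real.pi * j / (n + 1))) *
              cosineSeries n (triangle n) (Real.pi * j / (n + 1)) := by
          rw [hnode]
          linear_combination h1 / 2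
        have h3 := le_of_mul_le_mul_left h2 (by linarith)
        linarith
  have halt : ∑ j ∈ range (2 * (n + 1)),
      (-1) ^ j * cosineSeries n (u - triangle n) (Real.pi * j / (n + 1)) = 0 := by
    have h := sum_neg_one_pow_mul_fourierSeries hD
    simp only [fourierSeries_eq_cosineSeries hD hDsymm] at h
    exact_mod_cast h
  rw [sum_eq_zero_iff_of_nonneg hsign] at halt
  refine sub_eq_zero.mp (eq_zero_of_fourierSeries_nodes_eq_zero hD fun j hj => ?_)
  rw [fourierSeries_eq_cosineSeries hD hDsymm, Complex.ofReal_eq_zero]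
  exact (mul_eq_zero.mp (halt j hj)).resolve_left (pow_ne_zero _ (by norm_num))

theorem triangle_symbol_first_node (n : ℕ) :
    (2 - 2 * Real.cos (Real.pi * (1 : ℕ) / (n + 1))) *
        cosineSeries n (triangle n) (Real.pi * (1 : ℕ) / (n + 1)) =
      4 / ((n : ℝ) + 1) ^ 2 := by
  linear_combination 2 * triangle_symbol_node n 1

/-! ### The supremum of the Rayleigh-type quotients -/

theorem ContinuousLinearMap.norm_apply_le_iSup_div_mul (T : ℓ²(ℤ, ℂ) →L[ℂ] ℓ²(ℤ, ℂ))
    (f : ℓ²(ℤ, ℂ)) :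
    ‖T f‖ ≤ (⨆ g : {g : ℓ²(ℤ, ℂ) // g ≠ 0}, ‖T g‖ / ‖(g : ℓ²(ℤ, ℂ))‖) * ‖f‖ := by
  by_cases hf : f = 0
  · simp [hf]
  · rw [← div_le_iff₀ (norm_pos_iff.mpr hf)]
    -- An unbounded real supremum defaults to 0, so `‖T‖` is supplied as an upper bound.
    refine le_ciSup (f := fun g : {g : ℓ²(ℤ, ℂ) // g ≠ 0} => ‖T g‖ / ‖(g : ℓ²(ℤ, ℂ))‖)
      ⟨‖T‖, ?_⟩ ⟨f, hf⟩
    rintro _ ⟨g, rfl⟩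
    exact T.ratio_le_opNorm g

theorem theorem2 (n : ℕ) :
    (∀ u : ℤ → ℝ,
      -- `u` is a function on `{-n, …, n}`, extended by zero
      (∀ k : ℤ, (n : ℤ) < |k| → u k = 0) →
      (∀ k : ℤ, u (-k) = u k) →
      ∑ k ∈ Finset.Icc (-(n : ℤ)) n, u k = 1 →
      (∀ ξ : ℝ, 0 ≤ fourierSeries u ξ) →
      -- `T` is the (bounded) operator `f ↦ Δ(f * u)` on complex `ℓ²(ℤ)`
      ∃ T : ℓ²(ℤ, ℂ) →L[ℂ] ℓ²(ℤ, ℂ),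
        (∀ f : ℓ²(ℤ, ℂ), (T f : ℤ → ℂ) = discreteLaplacian (convolve f u)) ∧
        4 / ((n : ℝ) + 1) ^ 2 ≤ ⨆ f : {f : ℓ²(ℤ, ℂ) // f ≠ 0}, ‖T f‖ / ‖(f : ℓ²(ℤ, ℂ))‖ ∧
        ((⨆ f : {f : ℓ²(ℤ, ℂ) // f ≠ 0}, ‖T f‖ / ‖(f : ℓ²(ℤ, ℂ))‖) = 4 / ((n : ℝ) + 1) ^ 2 ↔
          u = triangle n)) ∧
    (∀ ξ : ℝ, fourierSeries (triangle n) ξ = (normalizedFejer n ξ : ℂ)) := by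
  refine ⟨fun u hu hsymm hsum hpos => ⟨laplacianConvolve n u, coe_laplacianConvolve hu, ?_⟩,
    fourierSeries_triangle n⟩
  have hnonneg : ∀ ξ, 0 ≤ cosineSeries n u ξ := fun ξ => by
    have h := hpos ξ
    rw [fourierSeries_eq_cosineSeries hu hsymm] at h
    exact_mod_cast h
  have hS : 0 ≤ ⨆ f : {f : ℓ²(ℤ, ℂ) // f ≠ 0},
      ‖laplacianConvolve n u f‖ / ‖(f : ℓ²(ℤ, ℂ))‖ :=
    Real.iSup_nonneg fun f => by positivity
  have hsymbol := symbol_le_of_norm_le hu hsymm hS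
    (laplacianConvolve n u).norm_apply_le_iSup_div_mul
  have hmin : (⨆ f : {f : ℓ²(ℤ, ℂ) // f ≠ 0},
      ‖laplacianConvolve n u f‖ / ‖(f : ℓ²(ℤ, ℂ))‖) ≤ 4 / ((n : ℝ) + 1) ^ 2 → u = triangle n :=
    fun h => eq_triangle_of_symbol_le hu hsymm hsum hnonneg fun ξ => (hsymbol ξ).trans h
  have hge : u = triangle n → 4 / ((n : ℝ) + 1) ^ 2 ≤ ⨆ f : {f : ℓ²(ℤ, ℂ) // f ≠ 0},
      ‖laplacianConvolve n u f‖ / ‖(f : ℓ²(ℤ, ℂ))‖ := by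
    rintro rfl
    rw [← triangle_symbol_first_node]
    exact hsymbol _
  refine ⟨?_, fun h => hmin h.le, fun h => le_antisymm ?_ (hge h)⟩
  -- A smaller supremum would force the triangle, whose supremum is not smaller.
  · by_contra! hlt
    exact hlt.not_ge (hge (hmin hlt.le))
  · subst h
    refine Real.iSup_le (fun f => ?_) (by positivity)
    rw [div_le_iff₀ (norm_pos_iff.mpr f.2)]
    exact norm_laplacianConvolve_triangle_le n f
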